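/- Let $G\subseteq\mathbb{R}^d$ with Borel $\sigma$-algebra $\mathcal{B}(G)$, let $\pi$ and $\nu$ be probability measures on $(G,\mathcal{B}(G))$, and let $K$ be a transition kernel on $(G,\mathcal{B}(G))$ that is reversible with respect to $\pi$, i.e. $\int_A K(x,B)\,\pi(dx)=\int_B K(x,A)\,\pi(dx)$ for all $A,B\in\mathcal{B}(G)$. Write $L_2=L_2(\pi)$ with norm $\|\cdot\|_2$, $L_2^0=\{f\in L_2:\int_G f\,d\pi=0\}$, $Pf(x)=\int_G f(y)\,K(x,dy)$ for the Markov operator of $K$, and \[ \Lambda=\sup\{\lambda\in\operatorname{spec}(P\mid L_2^0)\},\qquad \Lambda_0=\max\{0,\Lambda\} \] (with $\Lambda_0=0$ if $L_2^0=\{0\}$). Assume that $K$ is variance bounding, i.e. $\Lambda<1$, and that $\nu$ has a density $\frac{d\nu}{d\pi}\in L_2$ with respect to $\pi$. Let $\mathscr{A}\subseteq\mathcal{B}(G)$ be a set of test sets, and for every $\delta>0$ let $\Gamma_\delta\subseteq\mathcal{B}(G)$ be a $\delta$-cover of $\mathscr{A}$ with respect to $\pi$, that is, a finite set with $\emptyset\in\Gamma_\delta$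 such that for every $A\in\mathscr{A}$ there are $C,D\in\Gamma_\delta$ with $C\subseteq A\subseteq D$ and $\pi(D\setminus C)\le\delta$. Let $s\in\mathbb{N}$. Let $\varphi\colon G\times[0,1]^s\to G$ be any update function of $K$, i.e. a measurable function such that $K(x,A)=\mathbb{P}(\varphi(x;U)\in A)$ for all $x\in G$, $A\in\mathcal{B}(G)$, and let $\psi\colon[0,1]^s\to G$ be any generator function of $\nu$, i.e. a measurable function such that $\nu(A)=\mathbb{P}(\psi(U)\in A)$ for all $A\in\mathcal{B}(G)$, where $U$ is uniformly distributed on $[0,1]^s$. Then for every $n\ge 1$ and every $\delta>0$ there exists a driver sequence $u_0,\dots,u_{n-1}\in[0,1]^s$ such that the points $S_n=\{x_1,\dots,x_n\}$ (counted with multiplicity) given by $x_1=\psi(u_0)$ and $x_{i+1}=\varphi(x_i;u_i)$, $i=1,\dots,n-1$, satisfy \[ D^*_{\mathscr{A},\pi}(S_n):=\sup_{A\in\mathscr{A}}\Bigl|\frac1n\sum_{i=1}^n 1_{x_i\in A}-\pi(A)\Bigr| \le\sqrt{\frac{1+\Lambda_0}{1-\Lambda_0}}\cdot\frac{\sqrt{2\log\bigl(|\Gamma_\delta|^2\,\|\frac{d\nu}{d\pi}\|_2\bigr)}}{\sqrt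 n}+\delta . \] -/

import Mathlib

open MeasureTheory ProbabilityTheory
open scoped ENNReal

namespace MCQMC

noncomputable section

section MarkovOperator

variable {G : Type*} [MeasurableSpace G] {K : Kernel G G} {π : Measure G}

/-- The action `(P f)(x) = ∫ f(y) K(x, dy)` of a transition kernel on functions. -/
def kernelMean (K : Kernel G G) (f : G → ℝ) (x : G) : ℝ := ∫ y, f y ∂(K x)

theorem kernelMean_congr (hK : K.Invariant π) {f g : G → ℝ} (h : f =ᵐ[π] g) :
    kernelMean K f =ᵐ[π] kernelMean K g := by
  have h' : ∀ᵐ y ∂(π.bind K), f y = g y := by rw [hK.def]; exact h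
  filter_upwards [Measure.ae_ae_of_ae_comp h'] with x hx
  exact integral_congr_ae hx

theorem ae_integrable_kernel (hK : K.Invariant π) {f : G → ℝ} (hf : Integrable f π) :
    ∀ᵐ x ∂π, Integrable f (K x) := by
  have h' : Integrable f (π.bind K) := by rw [hK.def]; exact hf
  exact Measure.ae_integrable_of_integrable_comp h'

theorem stronglyMeasurable_kernelMean {f : G → ℝ} [IsMarkovKernel K]
    (hf : StronglyMeasurable f) : StronglyMeasurable (kernelMean K f) :=
  hf.integral_kernel

theorem eLpNorm_kernelMean_le [IsMarkovKernel K] (hK : K.Invariant π) {f : G → ℝ}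
    (hf : StronglyMeasurable f) : eLpNorm (kernelMean K f) 2 π ≤ eLpNorm f 2 π := by
  have key : ∀ x, ‖kernelMean K f x‖ₑ ^ (2 : ℝ) ≤ ∫⁻ y, ‖f y‖ₑ ^ (2 : ℝ) ∂(K x) := by
    intro x
    have h1 : ‖kernelMean K f x‖ₑ ≤ ∫⁻ y, ‖f y‖ₑ ∂(K x) := enorm_integral_le_lintegral_enorm _
    have h2 := eLpNorm_le_eLpNorm_of_exponent_le (μ := K x) (p := 1) (q := 2) (by norm_num)
      hf.aestronglyMeasurable
    rw [eLpNorm_one_eq_lintegral_enorm,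
      eLpNorm_eq_lintegral_rpow_enorm_toReal (by norm_num) (by norm_num)] at h2
    have h3 := ENNReal.rpow_le_rpow (h1.trans h2) (z := 2) (by norm_num)
    refine h3.trans (le_of_eq ?_)
    rw [← ENNReal.rpow_mul]
    norm_num
  rw [eLpNorm_eq_lintegral_rpow_enorm_toReal (by norm_num) (by norm_num),
    eLpNorm_eq_lintegral_rpow_enorm_toReal (by norm_num) (by norm_num)]
  refine ENNReal.rpow_le_rpow ?_ (by norm_num)
  simp only [ENNReal.toReal_ofNat]
  calc ∫⁻ x, ‖kernelMean K f x‖ₑ ^ (2 : ℝ) ∂π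
      ≤ ∫⁻ x, ∫⁻ y, ‖f y‖ₑ ^ (2 : ℝ) ∂(K x) ∂π := lintegral_mono key
    _ = ∫⁻ y, ‖f y‖ₑ ^ (2 : ℝ) ∂(π.bind K) :=
        (Measure.lintegral_bind K.aemeasurable
          (hf.enorm.pow_const _).aemeasurable).symm
    _ = ∫⁻ y, ‖f y‖ₑ ^ (2 : ℝ) ∂π := by rw [hK.def]

theorem memLp_kernelMean [IsMarkovKernel K] (hK : K.Invariant π) (f : Lp ℝ 2 π) :
    MemLp (kernelMean K f) 2 π :=
  ⟨(stronglyMeasurable_kernelMean (Lp.stronglyMeasurable f)).aestronglyMeasurable,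
    (eLpNorm_kernelMean_le hK (Lp.stronglyMeasurable f)).trans_lt (Lp.memLp f).2⟩

variable [IsProbabilityMeasure π]

/-- The Markov operator `P : L₂(π) → L₂(π)`, `(P f)(x) = ∫ f(y) K(x, dy)`, of a transition
kernel `K` with stationary distribution `π`. -/
def markovOperator (K : Kernel G G) [IsMarkovKernel K] (hK : K.Invariant π) :
    Lp ℝ 2 π →L[ℝ] Lp ℝ 2 π :=
  LinearMap.mkContinuous
    { toFun := fun f => (memLp_kernelMean hK f).toLp (kernelMean K f)
      map_add' := by
        intro f g
        rw [← MemLp.toLp_add]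
        refine MemLp.toLp_congr _ _ ((kernelMean_congr hK (Lp.coeFn_add f g)).trans ?_)
        filter_upwards [ae_integrable_kernel hK ((Lp.memLp f).integrable (by norm_num)),
          ae_integrable_kernel hK ((Lp.memLp g).integrable (by norm_num))] with x hf hg
        exact integral_add hf hg
      map_smul' := by
        intro c f
        rw [RingHom.id_apply, ← MemLp.toLp_const_smul]
        refine MemLp.toLp_congr _ _ ((kernelMean_congr hK (Lp.coeFn_smul c f)).trans ?_)
        filter_upwards with x
        exact integral_smul c _ }
    1 (by
      intro f
      rw [one_mul, LinearMap.coe_mk, AddHom.coe_mk, Lp.norm_toLp, Lp.norm_def]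
      exact ENNReal.toReal_mono (Lp.memLp f).2.ne
        (eLpNorm_kernelMean_le hK (Lp.stronglyMeasurable f)))

theorem coeFn_markovOperator (K : Kernel G G) [IsMarkovKernel K] (hK : K.Invariant π)
    (f : Lp ℝ 2 π) : markovOperator K hK f =ᵐ[π] kernelMean K f :=
  MemLp.coeFn_toLp (memLp_kernelMean hK f)

/-- The closed subspace `L₂⁰(π)` of all `f ∈ L₂(π)` with `∫ f dπ = 0`. -/
def meanZero (π : Measure G) [IsProbabilityMeasure π] : Submodule ℝ (Lp ℝ 2 π) where
  carrier := {f | ∫ x, f x ∂π = 0}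
  add_mem' := by
    intro f g hf hg
    rw [Set.mem_ofPred_eq] at hf hg ⊢
    rw [integral_congr_ae (Lp.coeFn_add f g)]
    have := integral_add ((Lp.memLp f).integrable (by norm_num))
      ((Lp.memLp g).integrable (by norm_num))
    simp only [Pi.add_apply]
    rw [this, hf, hg, add_zero]
  zero_mem' := by
    rw [Set.mem_ofPred_eq, integral_congr_ae (Lp.coeFn_zero ℝ 2 π)]
    simp
  smul_mem' := by
    intro c f hf
    rw [Set.mem_ofPred_eq] at hf ⊢
    rw [integral_congr_ae (Lp.coeFn_smul c f)]
    simp only [Pi.smul_apply]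
    rw [integral_smul, hf, smul_zero]

theorem markovOperator_mem_meanZero (K : Kernel G G) [IsMarkovKernel K] (hK : K.Invariant π) :
    ∀ f ∈ meanZero π, markovOperator K hK f ∈ meanZero π := by
  intro f hf
  have hf0 : ∫ x, f x ∂π = 0 := hf
  have hi : Integrable f ((K ∘ₖ Kernel.const Unit π) ()) := by
    rw [← Measure.comp_eq_comp_const_apply, hK.def]
    exact (Lp.memLp f).integrable (by norm_num)
  change ∫ x, markovOperator K hK f x ∂π = 0
  rw [integral_congr_ae (coeFn_markovOperator K hK f)]
  have := Kernel.integral_comp hi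
  rw [← Measure.comp_eq_comp_const_apply, hK.def, Kernel.const_apply] at this
  rw [← hf0, this]
  rfl

/-- The Markov operator restricted to `L₂⁰(π)`. -/
def markovOperatorZero (K : Kernel G G) [IsMarkovKernel K] (hK : K.Invariant π) :
    meanZero π →L[ℝ] meanZero π :=
  (markovOperator K hK).restrict (markovOperator_mem_meanZero K hK)

/-- `Λ = sup spec(P | L₂⁰)` for a reversible kernel. The operator is self-adjoint and of norm at
most one, so its spectrum is real and compact. It is empty only if `L₂⁰ = 0`, in which case the
real supremum is `0`; this does not affect `Λ < 1` or `max 0 Λ`. -/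
def spectralSup (K : Kernel G G) [IsMarkovKernel K] (hrev : K.IsReversible π) : ℝ :=
  sSup (spectrum ℝ (markovOperatorZero K hrev.invariant))

/-- A reversible kernel is variance bounding (has an `L₂`-spectral gap) if `Λ < 1`. -/
def IsVarianceBounding (K : Kernel G G) [IsMarkovKernel K] (hrev : K.IsReversible π) : Prop :=
  spectralSup K hrev < 1

end MarkovOperator

section Driver

variable {G : Type*} [MeasurableSpace G]

/-- The cube `[0,1]^s`; its `volume` is the uniform distribution. -/
abbrev Cube (s : ℕ) : Type := Fin s → unitInterval

/-- `φ` is an update function of `K`: it is jointly measurable and `K(x, A) = ℙ(φ(x; U) ∈ A)`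
for `U` uniform on `[0,1]^s`. -/
def IsUpdateFunction {s : ℕ} (K : Kernel G G) (φ : G → Cube s → G) : Prop :=
  Measurable (Function.uncurry φ) ∧
    ∀ (x : G) (A : Set G), MeasurableSet A → K x A = volume {u : Cube s | φ x u ∈ A}

/-- `ψ` is a generator function of `ν`: it is measurable and `ν(A) = ℙ(ψ(U) ∈ A)` for `U`
uniform on `[0,1]^s`. -/
def IsGeneratorFunction {s : ℕ} (ν : Measure G) (ψ : Cube s → G) : Prop :=
  Measurable ψ ∧ ∀ A : Set G, MeasurableSet A → ν A = volume {u : Cube s | ψ u ∈ A}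

/-- The point `x_{i+1}` driven by `u_0, …, u_{n-1}`, where `x_1 = ψ(u_0)` and
`x_{i+1} = φ(x_i; u_i)`. -/
def drivenPoint {s n : ℕ} (φ : G → Cube s → G) (ψ : Cube s → G) (u : Fin n → Cube s) :
    (i : ℕ) → i < n → G
  | 0, h => ψ (u ⟨0, h⟩)
  | i + 1, h => φ (drivenPoint φ ψ u i (Nat.lt_of_succ_lt h)) (u ⟨i + 1, h⟩)

/-- The points `S_n = (x_1, …, x_n)`, indexed from `0`. -/
def drivenPoints {s n : ℕ} (φ : G → Cube s → G) (ψ : Cube s → G) (u : Fin n → Cube s) :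
    Fin n → G :=
  fun i => drivenPoint φ ψ u i i.isLt

/-- The star-discrepancy
`sup_{A ∈ 𝒜} |(1/n) ∑ᵢ 1_{xᵢ ∈ A} - π(A)|` of a finite sequence of points. -/
def starDiscrepancy {n : ℕ} (𝒜 : Set (Set G)) (π : Measure G) (x : Fin n → G) : ℝ :=
  ⨆ A : 𝒜, |(1 / (n : ℝ)) * ∑ i, (A : Set G).indicator (fun _ => (1 : ℝ)) (x i) - π.real A|

/-- A finite set `Γ` of measurable sets, containing `∅`, is a `δ`-cover of `𝒜` with respect to
`π` if every `A ∈ 𝒜` lies between two members of `Γ` whose difference has measure at most `δ`. -/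
def IsDeltaCover (𝒜 : Set (Set G)) (π : Measure G) (δ : ℝ) (Γ : Finset (Set G)) : Prop :=
  (∀ C ∈ Γ, MeasurableSet C) ∧ ∅ ∈ Γ ∧
    ∀ A ∈ 𝒜, ∃ C ∈ Γ, ∃ D ∈ Γ, C ⊆ A ∧ A ⊆ D ∧ π.real (D \ C) ≤ δ

/-- The density `dν/dπ` as a real-valued function. -/
def density (ν π : Measure G) : G → ℝ := fun x => (ν.rnDeriv π x).toReal

end Driver

end

end MCQMC

/-!
With `l = max 0 Λ < 1`, the quadratic form `⟨f, K f⟩` in `L₂(π)` is bounded by that of the kernel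
which stays put with probability `l` and otherwise samples afresh from `π`. If `exp (-b)` dominates
the latter form, polarization makes `K` a contraction from `L₂(exp (-b) π)` to `L₂(exp b π)`, so the
moments `𝔼 exp (b(X₁) + ⋯ + b(Xₙ))` of the stationary chain are at most `1` for every `n`. This
applies to `b = (1 - l) (2 c (f - ∫ f dπ) - c²)` when `0 ≤ f ≤ 1`.

For the chain started from `ν`, the Cauchy–Schwarz inequality bounds the moment of `b / 2` by
`‖dν/dπ‖₂`, and Markov's inequality then bounds the probability of a deviation larger than `c` of
the empirical mean by `2 ‖dν/dπ‖₂ exp (-n (1 - l) c² / 2)`. For the `c` of the theorem, the sum of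
these probabilities over the nonempty sets of the `δ`-cover is less than `1`, so some driver
sequence serves all of them at once, and passing from the cover to `𝒜` costs `δ`.
-/

namespace MCQMC

section SpectralBound

variable {H : Type*} [NormedAddCommGroup H] [InnerProductSpace ℝ H] [CompleteSpace H]

/-- The shift by `‖A‖` makes the spectrum nonnegative, so that the spectral radius, which is the
norm, becomes the top of the spectrum. -/
theorem norm_algebraMap_norm_add_le [Nontrivial H] {A : H →L[ℝ] H} (hA : IsSelfAdjoint A) :
    ‖algebraMap ℝ (H →L[ℝ] H) ‖A‖ + A‖ ≤ ‖A‖ + sSup (spectrum ℝ A) := by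
  have h_abs (r) (hr : r ∈ spectrum ℝ A) : |r| ≤ ‖A‖ := spectrum.norm_le_norm_of_mem hr
  have h_le (r) (hr : r ∈ spectrum ℝ A) : r ≤ sSup (spectrum ℝ A) :=
    le_csSup (spectrum.isBounded A).bddAbove hr
  have h_nonneg : 0 ≤ ‖A‖ + sSup (spectrum ℝ A) := by
    rcases (spectrum ℝ A).eq_empty_or_nonempty with h | ⟨r, hr⟩
    · simp [h]
    · linarith [neg_abs_le r, h_abs r hr, h_le r hr]
  have hT : IsSelfAdjoint (algebraMap ℝ (H →L[ℝ] H) ‖A‖ + A) :=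
    ((IsSelfAdjoint.all ‖A‖).algebraMap _).add hA
  rw [← ENNReal.ofReal_le_ofReal_iff h_nonneg, ofReal_norm, enorm_eq_nnnorm,
    ← ContinuousLinearMap.spectralRadius_eq_nnnorm _ hT]
  refine iSup₂_le fun k hk => ?_
  rw [← spectrum.singleton_add_eq, Set.singleton_add] at hk
  obtain ⟨r, hr, rfl⟩ := hk
  rw [← enorm_eq_nnnorm, ← ofReal_norm, ENNReal.ofReal_le_ofReal_iff h_nonneg, Real.norm_eq_abs,
    abs_of_nonneg (by linarith [neg_abs_le r, h_abs r hr])]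
  linarith [h_le r hr]

theorem inner_apply_self_le_sSup_spectrum {A : H →L[ℝ] H} (hA : IsSelfAdjoint A) (x : H) :
    inner ℝ (A x) x ≤ sSup (spectrum ℝ A) * ‖x‖ ^ 2 := by
  obtain rfl | hx := eq_or_ne x 0
  · simp
  have : Nontrivial H := nontrivial_of_ne x 0 hx
  set T : H →L[ℝ] H := algebraMap ℝ _ ‖A‖ + A with hT
  have hTx : inner ℝ (T x) x = ‖A‖ * ‖x‖ ^ 2 + inner ℝ (A x) x := by
    simp [hT, inner_add_left, real_inner_smul_left]
  have hTx_le : inner ℝ (T x) x ≤ (‖A‖ + sSup (spectrum ℝ A)) * ‖x‖ ^ 2 := calc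
    inner ℝ (T x) x ≤ ‖T x‖ * ‖x‖ := real_inner_le_norm _ _
    _ ≤ (‖T‖ * ‖x‖) * ‖x‖ := by gcongr; exact T.le_opNorm x
    _ = ‖T‖ * ‖x‖ ^ 2 := by ring
    _ ≤ _ := by gcongr; exact norm_algebraMap_norm_add_le hA
  linarith

end SpectralBound

section BoundedMeasurable

variable {X Y : Type*} [MeasurableSpace X] [MeasurableSpace Y]

/-- Bounded measurable real-valued functions: the class of integrands of the whole argument, closed
under all the operations it needs and integrable for every finite measure. -/
@[fun_prop]
def IsBddMeas (f : X → ℝ) : Prop := Measurable f ∧ ∃ C, ∀ x, |f x| ≤ C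

namespace IsBddMeas

variable {f g : X → ℝ}

@[fun_prop]
theorem const (c : ℝ) : IsBddMeas (fun _ : X => c) := ⟨measurable_const, |c|, fun _ => le_rfl⟩

@[fun_prop]
theorem add (hf : IsBddMeas f) (hg : IsBddMeas g) : IsBddMeas (fun x => f x + g x) := by
  obtain ⟨hf, C, hC⟩ := hf
  obtain ⟨hg, D, hD⟩ := hg
  exact ⟨hf.add hg, C + D, fun x => (abs_add_le _ _).trans (add_le_add (hC x) (hD x))⟩

@[fun_prop]
theorem mul (hf : IsBddMeas f) (hg : IsBddMeas g) : IsBddMeas (fun x => f x * g x) := by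
  obtain ⟨hf, C, hC⟩ := hf
  obtain ⟨hg, D, hD⟩ := hg
  refine ⟨hf.mul hg, C * D, fun x => ?_⟩
  rw [abs_mul]
  exact mul_le_mul (hC x) (hD x) (abs_nonneg _) ((abs_nonneg _).trans (hC x))

@[fun_prop]
theorem neg (hf : IsBddMeas f) : IsBddMeas (fun x => -f x) := by
  simpa using (const (-1)).mul hf

@[fun_prop]
theorem sub (hf : IsBddMeas f) (hg : IsBddMeas g) : IsBddMeas (fun x => f x - g x) := by
  simpa only [sub_eq_add_neg] using hf.add hg.neg

@[fun_prop]
theorem pow (hf : IsBddMeas f) (k : ℕ) : IsBddMeas (fun x => f x ^ k) := by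
  induction k with
  | zero => simpa using const 1
  | succ k ih => simpa only [pow_succ] using ih.mul hf

@[fun_prop]
theorem abs (hf : IsBddMeas f) : IsBddMeas (fun x => |f x|) :=
  ⟨hf.1.abs, hf.2.imp fun _ hC x => by simpa using hC x⟩

@[fun_prop]
theorem exp (hf : IsBddMeas f) : IsBddMeas (fun x => Real.exp (f x)) := by
  obtain ⟨hf, C, hC⟩ := hf
  refine ⟨hf.exp, Real.exp C, fun x => ?_⟩
  rw [abs_of_pos (Real.exp_pos _)]
  exact Real.exp_le_exp.mpr ((le_abs_self _).trans (hC x))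

theorem inv_of_le {c : ℝ} (hf : Measurable f) (hc : 0 < c) (hcf : ∀ x, c ≤ f x) :
    IsBddMeas (fun x => (f x)⁻¹) := by
  refine ⟨hf.inv, c⁻¹, fun x => ?_⟩
  rw [abs_of_pos (inv_pos.mpr (hc.trans_le (hcf x)))]
  exact inv_anti₀ hc (hcf x)

theorem of_mem_Icc {a b : ℝ} (hf : Measurable f) (hf_mem : ∀ x, f x ∈ Set.Icc a b) :
    IsBddMeas f :=
  ⟨hf, max |a| |b|, fun x => abs_le_max_abs_abs (hf_mem x).1 (hf_mem x).2⟩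

theorem comp (hf : IsBddMeas f) {h : Y → X} (hh : Measurable h) : IsBddMeas (fun y => f (h y)) :=
  ⟨hf.1.comp hh, hf.2.imp fun _ hC y => hC (h y)⟩

theorem sum {ι : Type*} (t : Finset ι) {f : ι → X → ℝ} (hf : ∀ i ∈ t, IsBddMeas (f i)) :
    IsBddMeas (fun x => ∑ i ∈ t, f i x) := by
  choose! hm C hC using hf
  refine ⟨Finset.measurable_fun_sum t hm, ∑ i ∈ t, C i, fun x => ?_⟩
  exact (Finset.abs_sum_le_sum_abs _ _).trans (Finset.sum_le_sum fun i hi => hC i hi x)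

theorem memLp (hf : IsBddMeas f) (μ : Measure X) [IsFiniteMeasure μ] (p : ℝ≥0∞) :
    MemLp f p μ := by
  obtain ⟨hf, C, hC⟩ := hf
  exact MemLp.of_bound hf.aestronglyMeasurable C (Filter.Eventually.of_forall hC)

theorem integrable (hf : IsBddMeas f) (μ : Measure X) [IsFiniteMeasure μ] : Integrable f μ :=
  memLp_one_iff_integrable.mp (hf.memLp μ 1)

@[fun_prop]
theorem kernelMean {K : Kernel X X} [IsMarkovKernel K] (hf : IsBddMeas f) :
    IsBddMeas (kernelMean K f) := by
  obtain ⟨hf, C, hC⟩ := hf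
  refine ⟨(stronglyMeasurable_kernelMean hf.stronglyMeasurable).measurable, C, fun x => ?_⟩
  simpa [MCQMC.kernelMean] using
    norm_integral_le_of_norm_le_const (μ := K x) (f := f) (Filter.Eventually.of_forall hC)

end IsBddMeas

theorem sq_integral_le_integral_mul_integral (μ : Measure X) [IsFiniteMeasure μ] {v w f : X → ℝ}
    (hv : IsBddMeas v) (hw : IsBddMeas w) (hw_nonneg : ∀ x, 0 ≤ w x) (hvw : ∀ x, v x * w x = 1)
    (hf : IsBddMeas f) : (∫ x, f x ∂μ) ^ 2 ≤ (∫ x, v x ∂μ) * ∫ x, w x * f x ^ 2 ∂μ := by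
  have h_quadratic (t : ℝ) :
      0 ≤ (∫ x, v x ∂μ) * (t * t) + (-2 * ∫ x, f x ∂μ) * t + ∫ x, w x * f x ^ 2 ∂μ := calc
    0 ≤ ∫ x, w x * (f x - t * v x) ^ 2 ∂μ :=
      integral_nonneg fun x => mul_nonneg (hw_nonneg x) (sq_nonneg _)
    _ = ∫ x, (w x * f x ^ 2 - (2 * t) * f x + (t * t) * v x) ∂μ := by
      congr with x
      linear_combination ((t * t) * v x - 2 * t * f x) * hvw x
    _ = _ := by
      rw [integral_add (IsBddMeas.integrable (by fun_prop) _)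
        (IsBddMeas.integrable (by fun_prop) _),
        integral_sub (IsBddMeas.integrable (by fun_prop) _)
          (IsBddMeas.integrable (by fun_prop) _), integral_const_mul, integral_const_mul]
      ring
  have := discrim_le_zero h_quadratic
  simp only [discrim] at this
  linarith

end BoundedMeasurable

section Reversible

variable {G : Type*} [MeasurableSpace G] {K : Kernel G G} [IsMarkovKernel K] {π : Measure G}
  [IsFiniteMeasure π]

theorem kernelMean_const (c : ℝ) (x : G) : kernelMean K (fun _ => c) x = c := by
  simp [kernelMean]

theorem kernelMean_add {f g : G → ℝ} (hf : IsBddMeas f) (hg : IsBddMeas g) (x : G) :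
    kernelMean K (fun x => f x + g x) x = kernelMean K f x + kernelMean K g x :=
  integral_add (hf.integrable _) (hg.integrable _)

theorem kernelMean_sub {f g : G → ℝ} (hf : IsBddMeas f) (hg : IsBddMeas g) (x : G) :
    kernelMean K (fun x => f x - g x) x = kernelMean K f x - kernelMean K g x :=
  integral_sub (hf.integrable _) (hg.integrable _)

theorem sq_kernelMean_le {f : G → ℝ} (hf : IsBddMeas f) (x : G) :
    kernelMean K f x ^ 2 ≤ kernelMean K (fun y => f y ^ 2) x := by
  simpa [kernelMean] using sq_integral_le_integral_mul_integral (K x)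
    (.const 1) (.const 1) (fun _ => zero_le_one) (fun _ => mul_one 1) hf

theorem compProd_map_swap (hrev : K.IsReversible π) : (π ⊗ₘ K).map Prod.swap = π ⊗ₘ K := by
  have : IsFiniteMeasure ((π ⊗ₘ K).map Prod.swap) := Measure.isFiniteMeasure_map _ _
  refine Measure.ext_prod fun {s t} hs ht => ?_
  rw [Measure.map_apply measurable_swap (hs.prod ht), Set.preimage_swap_prod,
    Measure.compProd_apply_prod ht hs, Measure.compProd_apply_prod hs ht, hrev ht hs]

theorem integrable_mul_compProd (hK : K.Invariant π) {f g : G → ℝ}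
    (hf : MemLp f 2 π) (hg : MemLp g 2 π) :
    Integrable (fun z : G × G => f z.1 * g z.2) (π ⊗ₘ K) :=
  (hf.comp_measurePreserving ⟨measurable_fst, Measure.fst_compProd π K⟩).integrable_mul
    (hg.comp_measurePreserving ⟨measurable_snd, (Measure.snd_compProd π K).trans hK.def⟩)

theorem integral_compProd_mul (hK : K.Invariant π) {f g : G → ℝ}
    (hf : MemLp f 2 π) (hg : MemLp g 2 π) :
    ∫ z, f z.1 * g z.2 ∂(π ⊗ₘ K) = ∫ x, f x * kernelMean K g x ∂π := by
  rw [Measure.integral_compProd (integrable_mul_compProd hK hf hg)]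
  simp only [integral_const_mul, kernelMean]

theorem integral_mul_kernelMean_comm (hrev : K.IsReversible π) {f g : G → ℝ}
    (hf : MemLp f 2 π) (hg : MemLp g 2 π) :
    ∫ x, f x * kernelMean K g x ∂π = ∫ x, g x * kernelMean K f x ∂π := by
  have hfg := integrable_mul_compProd hrev.invariant hf hg
  rw [← integral_compProd_mul hrev.invariant hf hg, ← integral_compProd_mul hrev.invariant hg hf,
    ← compProd_map_swap hrev,
    integral_map measurable_swap.aemeasurable
      ((compProd_map_swap hrev).symm ▸ hfg.aestronglyMeasurable), compProd_map_swap hrev]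
  simp only [Prod.fst_swap, Prod.snd_swap, mul_comm]

theorem integral_kernelMean (hrev : K.IsReversible π) {f : G → ℝ} (hf : MemLp f 2 π) :
    ∫ x, kernelMean K f x ∂π = ∫ x, f x ∂π := by
  simpa [kernelMean_const] using integral_mul_kernelMean_comm hrev (memLp_const 1) hf

theorem neg_integral_mul_kernelMean_self_le {f : G → ℝ} (hf : IsBddMeas f) :
    -∫ x, f x * kernelMean K f x ∂π ≤ ∫ x, |f x| * kernelMean K (fun y => |f y|) x ∂π := by
  rw [← integral_neg]
  refine integral_mono (IsBddMeas.integrable (by fun_prop) _)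
    (IsBddMeas.integrable (by fun_prop) _) fun x => ?_
  calc -(f x * kernelMean K f x) ≤ |f x * kernelMean K f x| := neg_le_abs _
    _ = |f x| * |kernelMean K f x| := abs_mul _ _
    _ ≤ |f x| * kernelMean K (fun y => |f y|) x := by
      gcongr
      exact abs_integral_le_integral_abs

end Reversible

section SpectralForm

variable {G : Type*} [MeasurableSpace G] {K : Kernel G G} [IsMarkovKernel K] {π : Measure G}
  [IsProbabilityMeasure π]

theorem inner_markovOperator (hK : K.Invariant π) (f g : Lp ℝ 2 π) :
    inner ℝ (markovOperator K hK f) g = ∫ x, g x * kernelMean K f x ∂π := by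
  rw [L2.inner_def]
  refine integral_congr_ae ?_
  filter_upwards [coeFn_markovOperator K hK f] with x hx
  simp [hx]

theorem isClosed_meanZero : IsClosed (meanZero π : Set (Lp ℝ 2 π)) := by
  have h (f : Lp ℝ 2 π) : inner ℝ (indicatorConstLp 2 .univ (measure_ne_top π _) (1 : ℝ)) f
      = ∫ x, f x ∂π := by
    rw [L2.inner_indicatorConstLp_one, setIntegral_univ]
  change IsClosed {f : Lp ℝ 2 π | ∫ x, f x ∂π = 0}
  simp_rw [← h]
  exact isClosed_eq (by fun_prop) continuous_const

instance : CompleteSpace (meanZero π) := isClosed_meanZero.completeSpace_coe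

theorem isSelfAdjoint_markovOperatorZero (hrev : K.IsReversible π) :
    IsSelfAdjoint (markovOperatorZero K hrev.invariant) := by
  refine ContinuousLinearMap.isSelfAdjoint_iff_isSymmetric.mpr fun f g => ?_
  change inner ℝ (markovOperator K hrev.invariant f) (g : Lp ℝ 2 π)
    = inner ℝ (f : Lp ℝ 2 π) (markovOperator K hrev.invariant g)
  rw [real_inner_comm _ (f : Lp ℝ 2 π), inner_markovOperator, inner_markovOperator,
    integral_mul_kernelMean_comm hrev (Lp.memLp _) (Lp.memLp _)]

theorem integral_mul_kernelMean_le_of_integral_eq_zero (hrev : K.IsReversible π) {f : G → ℝ}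
    (hf : MemLp f 2 π) (hf_zero : ∫ x, f x ∂π = 0) :
    ∫ x, f x * kernelMean K f x ∂π ≤ spectralSup K hrev * ∫ x, f x ^ 2 ∂π := by
  have hF : hf.toLp f =ᵐ[π] f := hf.coeFn_toLp
  have hF_mem : hf.toLp f ∈ meanZero π := (integral_congr_ae hF).trans hf_zero
  have h_inner : inner ℝ (markovOperatorZero K hrev.invariant ⟨_, hF_mem⟩)
      (⟨_, hF_mem⟩ : meanZero π) = ∫ x, f x * kernelMean K f x ∂π := by
    refine (inner_markovOperator hrev.invariant (hf.toLp f) (hf.toLp f)).trans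
      (integral_congr_ae ?_)
    filter_upwards [hF, kernelMean_congr hrev.invariant hF] with x hx hx'
    rw [hx, hx']
  have h_norm : ‖(⟨_, hF_mem⟩ : meanZero π)‖ ^ 2 = ∫ x, f x ^ 2 ∂π := by
    rw [← real_inner_self_eq_norm_sq]
    refine (L2.inner_def (𝕜 := ℝ) _ _).trans (integral_congr_ae ?_)
    filter_upwards [hF] with x hx
    simp [hx]
  rw [← h_inner, ← h_norm]
  exact inner_apply_self_le_sSup_spectrum (isSelfAdjoint_markovOperatorZero hrev) _

theorem integral_mul_kernelMean_sub_const (hrev : K.IsReversible π) {f : G → ℝ}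
    (hf : IsBddMeas f) (c : ℝ) :
    ∫ x, (f x - c) * kernelMean K (fun y => f y - c) x ∂π =
      ∫ x, f x * kernelMean K f x ∂π - 2 * c * ∫ x, f x ∂π + c ^ 2 := by
  simp_rw [kernelMean_sub hf (.const c), kernelMean_const]
  calc ∫ x, (f x - c) * (kernelMean K f x - c) ∂π
      = ∫ x, (f x * kernelMean K f x - c * kernelMean K f x - c * f x + c ^ 2) ∂π := by
        congr with x; ring
    _ = _ := by
        rw [integral_add (IsBddMeas.integrable (by fun_prop) _) (integrable_const _),
          integral_sub (IsBddMeas.integrable (by fun_prop) _)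
            (IsBddMeas.integrable (by fun_prop) _),
          integral_sub (IsBddMeas.integrable (by fun_prop) _)
            (IsBddMeas.integrable (by fun_prop) _), integral_const_mul, integral_const_mul,
          integral_kernelMean hrev (hf.memLp π 2)]
        simp only [integral_const, probReal_univ, one_smul]
        ring

theorem integral_mul_kernelMean_self_le (hrev : K.IsReversible π) {l : ℝ}
    (hl : spectralSup K hrev ≤ l) {f : G → ℝ} (hf : IsBddMeas f) :
    ∫ x, f x * kernelMean K f x ∂π ≤
      (1 - l) * (∫ x, f x ∂π) ^ 2 + l * ∫ x, f x ^ 2 ∂π := by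
  set c := ∫ x, f x ∂π with hc
  have hf_c : IsBddMeas (fun x => f x - c) := by fun_prop
  have h_mean : ∫ x, (f x - c) ∂π = 0 := by
    rw [integral_sub (hf.integrable π) (integrable_const c)]
    simp [hc]
  have h_var : ∫ x, (f x - c) ^ 2 ∂π = ∫ x, f x ^ 2 ∂π - c ^ 2 := by
    rw [← variance_eq_integral hf.1.aemeasurable, variance_eq_sub (hf.memLp π 2)]
    rfl
  have h_form := (integral_mul_kernelMean_le_of_integral_eq_zero hrev (hf_c.memLp π 2) h_mean).trans
    (mul_le_mul_of_nonneg_right hl (integral_nonneg fun x => sq_nonneg _))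
  rw [integral_mul_kernelMean_sub_const hrev hf, h_var, ← hc] at h_form
  linarith

end SpectralForm

section WeightedContraction

variable {G : Type*} [MeasurableSpace G] {K : Kernel G G} [IsMarkovKernel K] {π : Measure G}
  [IsFiniteMeasure π]

theorem integral_kernelMean_add_sub_integral_kernelMean_sub (hrev : K.IsReversible π) {f g : G → ℝ}
    (hf : IsBddMeas f) (hg : IsBddMeas g) :
    ∫ x, (f x + g x) * kernelMean K (fun y => f y + g y) x ∂π
        - ∫ x, (f x - g x) * kernelMean K (fun y => f y - g y) x ∂π =
      4 * ∫ x, f x * kernelMean K g x ∂π := by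
  rw [← integral_sub (IsBddMeas.integrable (by fun_prop) _) (IsBddMeas.integrable (by fun_prop) _)]
  calc _ = ∫ x, (2 * (f x * kernelMean K g x) + 2 * (g x * kernelMean K f x)) ∂π := by
        congr with x
        rw [kernelMean_add hf hg, kernelMean_sub hf hg]
        ring
    _ = _ := by
        rw [integral_add (IsBddMeas.integrable (by fun_prop) _)
          (IsBddMeas.integrable (by fun_prop) _), integral_const_mul, integral_const_mul,
          integral_mul_kernelMean_comm hrev (hg.memLp π 2) (hf.memLp π 2)]
        ring

theorem integral_mul_sq_add_add_integral_mul_sq_sub {v f g : G → ℝ}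
    (hv : IsBddMeas v) (hf : IsBddMeas f) (hg : IsBddMeas g) :
    ∫ x, v x * (f x + g x) ^ 2 ∂π + ∫ x, v x * (f x - g x) ^ 2 ∂π =
      2 * ∫ x, v x * f x ^ 2 ∂π + 2 * ∫ x, v x * g x ^ 2 ∂π := by
  rw [← integral_add (IsBddMeas.integrable (by fun_prop) _) (IsBddMeas.integrable (by fun_prop) _),
    ← integral_const_mul, ← integral_const_mul,
    ← integral_add (IsBddMeas.integrable (by fun_prop) _) (IsBddMeas.integrable (by fun_prop) _)]
  congr with x
  ring

/-- Both `±⟨f, K f⟩` are bounded by the weighted norm of `f`; polarization turns this into a bound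
on the bilinear form. -/
theorem integral_exp_mul_sq_kernelMean_le (hrev : K.IsReversible π) {b : G → ℝ}
    (hb : IsBddMeas b)
    (hform : ∀ f, IsBddMeas f →
      ∫ x, f x * kernelMean K f x ∂π ≤ ∫ x, Real.exp (-b x) * f x ^ 2 ∂π)
    {f : G → ℝ} (hf : IsBddMeas f) :
    ∫ x, Real.exp (b x) * kernelMean K f x ^ 2 ∂π ≤ ∫ x, Real.exp (-b x) * f x ^ 2 ∂π := by
  set g : G → ℝ := fun x => Real.exp (b x) * kernelMean K f x
  have hg : IsBddMeas g := by fun_prop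
  have h_exp (x) : Real.exp (-b x) * Real.exp (b x) = 1 := by rw [← Real.exp_add]; simp
  have h_add := hform _ (hg.add hf)
  have h_sub := (neg_integral_mul_kernelMean_self_le (hg.sub hf)).trans (hform _ (hg.sub hf).abs)
  simp only [sq_abs] at h_sub
  have h_pol := integral_kernelMean_add_sub_integral_kernelMean_sub hrev hg hf
  have h_par := integral_mul_sq_add_add_integral_mul_sq_sub (π := π) hb.neg.exp hg hf
  have h_bilin : ∫ x, g x * kernelMean K f x ∂π
      = ∫ x, Real.exp (b x) * kernelMean K f x ^ 2 ∂π := by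
    congr with x
    ring
  have h_norm : ∫ x, Real.exp (-b x) * g x ^ 2 ∂π
      = ∫ x, Real.exp (b x) * kernelMean K f x ^ 2 ∂π := by
    congr with x
    linear_combination Real.exp (b x) * kernelMean K f x ^ 2 * h_exp x
  linarith

end WeightedContraction

section FeynmanKac

variable {G : Type*} [MeasurableSpace G]

/-- The Feynman–Kac functional `𝔼ₓ exp(b(X₁) + ⋯ + b(Xₙ))` of the Markov chain with kernel `K` that
starts at `X₁ = x`. The recursion conditions on the first step, so no path space is needed. -/
noncomputable def feynmanKac (K : Kernel G G) (b : G → ℝ) : ℕ → G → ℝ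
  | 0 => fun _ => 1
  | n + 1 => fun x => Real.exp (b x) * kernelMean K (feynmanKac K b n) x

theorem feynmanKac_nonneg (K : Kernel G G) (b : G → ℝ) (n : ℕ) (x : G) :
    0 ≤ feynmanKac K b n x := by
  induction n generalizing x with
  | zero => exact zero_le_one
  | succ n ih => exact mul_nonneg (Real.exp_pos _).le (integral_nonneg ih)

variable {K : Kernel G G} [IsMarkovKernel K] {π : Measure G} {b : G → ℝ} {l : ℝ}

@[fun_prop]
theorem IsBddMeas.feynmanKac (hb : IsBddMeas b) (n : ℕ) : IsBddMeas (feynmanKac K b n) := by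
  induction n with
  | zero => exact .const 1
  | succ n ih => exact hb.exp.mul ih.kernelMean

theorem sq_feynmanKac_le (hb : IsBddMeas b) (n : ℕ) (x : G) :
    feynmanKac K b n x ^ 2 ≤ feynmanKac K (fun y => 2 * b y) n x := by
  induction n generalizing x with
  | zero => simp [feynmanKac]
  | succ n ih => calc
      feynmanKac K b (n + 1) x ^ 2
          = Real.exp (2 * b x) * kernelMean K (feynmanKac K b n) x ^ 2 := by
        rw [feynmanKac, mul_pow, ← Real.exp_nat_mul, Nat.cast_ofNat]
      _ ≤ Real.exp (2 * b x) * kernelMean K (fun y => feynmanKac K b n y ^ 2) x := by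
        gcongr
        exact sq_kernelMean_le (hb.feynmanKac n) x
      _ ≤ feynmanKac K (fun y => 2 * b y) (n + 1) x := by
        refine mul_le_mul_of_nonneg_left ?_ (Real.exp_pos _).le
        exact integral_mono (IsBddMeas.integrable (by fun_prop) _)
          (IsBddMeas.integrable (by fun_prop) _) ih

/-- `exp (-b)` dominates the quadratic form of the kernel that stays put with probability `l` and
otherwise moves to an independent sample of `π`. Under every reversible kernel with spectral
supremum at most `l`, this bounds the stationary exponential moments of `b(X₁) + ⋯ + b(Xₙ)`. -/
def IsSubcritical (π : Measure G) (l : ℝ) (b : G → ℝ) : Prop :=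
  ∀ f, IsBddMeas f →
    (1 - l) * (∫ x, f x ∂π) ^ 2 + l * ∫ x, f x ^ 2 ∂π ≤ ∫ x, Real.exp (-b x) * f x ^ 2 ∂π

theorem IsSubcritical.of_integral_inv_le_one [IsFiniteMeasure π] {D : G → ℝ} (hl : l ≤ 1)
    (hb : IsBddMeas b) (hD : IsBddMeas D) (hD_inv : IsBddMeas fun x => (D x)⁻¹)
    (hD_pos : ∀ x, 0 < D x) (hD_int : ∫ x, (D x)⁻¹ ∂π ≤ 1)
    (hDb : ∀ x, l + (1 - l) * D x ≤ Real.exp (-b x)) :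
    IsSubcritical π l b := by
  intro f hf
  have h_sq : (∫ x, f x ∂π) ^ 2 ≤ ∫ x, D x * f x ^ 2 ∂π := calc
    (∫ x, f x ∂π) ^ 2 ≤ (∫ x, (D x)⁻¹ ∂π) * ∫ x, D x * f x ^ 2 ∂π :=
      sq_integral_le_integral_mul_integral π hD_inv hD (fun x => (hD_pos x).le)
        (fun x => inv_mul_cancel₀ (hD_pos x).ne') hf
    _ ≤ ∫ x, D x * f x ^ 2 ∂π := mul_le_of_le_one_left
      (integral_nonneg fun x => mul_nonneg (hD_pos x).le (sq_nonneg _)) hD_int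
  calc (1 - l) * (∫ x, f x ∂π) ^ 2 + l * ∫ x, f x ^ 2 ∂π
      ≤ (1 - l) * ∫ x, D x * f x ^ 2 ∂π + l * ∫ x, f x ^ 2 ∂π := by
        gcongr
    _ = ∫ x, (l + (1 - l) * D x) * f x ^ 2 ∂π := by
        rw [← integral_const_mul, ← integral_const_mul, ← integral_add
          (IsBddMeas.integrable (by fun_prop) _) (IsBddMeas.integrable (by fun_prop) _)]
        congr with x
        ring
    _ ≤ _ := integral_mono ((((IsBddMeas.const l).add ((IsBddMeas.const _).mul hD)).mul
        (hf.pow 2)).integrable _) ((hb.neg.exp.mul (hf.pow 2)).integrable _)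
        fun x => mul_le_mul_of_nonneg_right (hDb x) (sq_nonneg _)

variable [IsProbabilityMeasure π]

theorem IsSubcritical.integral_exp_le_one (hcrit : IsSubcritical π l b) (hl : 0 ≤ l)
    (hb : IsBddMeas b) : ∫ x, Real.exp (b x) ∂π ≤ 1 := by
  have h_form := hcrit _ hb.exp
  have h_exp : ∫ x, Real.exp (-b x) * Real.exp (b x) ^ 2 ∂π = ∫ x, Real.exp (b x) ∂π := by
    congr with x
    rw [← Real.exp_nat_mul, ← Real.exp_add]
    congr 1
    push_cast
    ring
  have h_sq : (∫ x, Real.exp (b x) ∂π) ^ 2 ≤ ∫ x, Real.exp (b x) ^ 2 ∂π := by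
    simpa using sq_integral_le_integral_mul_integral π (.const 1) (.const 1)
      (fun _ => zero_le_one) (fun _ => mul_one 1) hb.exp
  nlinarith [mul_le_mul_of_nonneg_left h_sq hl]

theorem IsSubcritical.integral_exp_neg_mul_sq_feynmanKac_le_one (hcrit : IsSubcritical π l b)
    (hrev : K.IsReversible π) (hΛl : spectralSup K hrev ≤ l) (hl : 0 ≤ l) (hb : IsBddMeas b)
    (n : ℕ) : ∫ x, Real.exp (-b x) * feynmanKac K b (n + 1) x ^ 2 ∂π ≤ 1 := by
  have h_step (n) : ∫ x, Real.exp (-b x) * feynmanKac K b (n + 1) x ^ 2 ∂π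
      = ∫ x, Real.exp (b x) * kernelMean K (feynmanKac K b n) x ^ 2 ∂π := by
    congr with x
    have h_exp : Real.exp (-b x) * Real.exp (b x) = 1 := by rw [← Real.exp_add]; simp
    rw [feynmanKac]
    linear_combination Real.exp (b x) * kernelMean K (feynmanKac K b n) x ^ 2 * h_exp
  induction n with
  | zero =>
    rw [h_step]
    simpa [feynmanKac, kernelMean_const] using hcrit.integral_exp_le_one hl hb
  | succ n ih =>
    rw [h_step]
    refine (integral_exp_mul_sq_kernelMean_le hrev hb (fun f hf => ?_) (hb.feynmanKac _)).trans ih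
    exact (integral_mul_kernelMean_self_le hrev hΛl hf).trans (hcrit f hf)

theorem IsSubcritical.integral_feynmanKac_le_one (hcrit : IsSubcritical π l b)
    (hrev : K.IsReversible π) (hΛl : spectralSup K hrev ≤ l) (hl : 0 ≤ l) (hb : IsBddMeas b)
    (n : ℕ) : ∫ x, feynmanKac K b n x ∂π ≤ 1 := by
  cases n with
  | zero => simp [feynmanKac]
  | succ n =>
    refine (le_abs_self _).trans ((sq_le_one_iff_abs_le_one _).mp ?_)
    calc (∫ x, feynmanKac K b (n + 1) x ∂π) ^ 2
        ≤ (∫ x, Real.exp (b x) ∂π)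
            * ∫ x, Real.exp (-b x) * feynmanKac K b (n + 1) x ^ 2 ∂π :=
          sq_integral_le_integral_mul_integral π hb.exp hb.neg.exp (fun _ => (Real.exp_pos _).le)
            (fun x => by rw [← Real.exp_add]; simp) (hb.feynmanKac _)
      _ ≤ 1 := mul_le_one₀ (hcrit.integral_exp_le_one hl hb)
          (integral_nonneg fun x => mul_nonneg (Real.exp_pos _).le (sq_nonneg _))
          (hcrit.integral_exp_neg_mul_sq_feynmanKac_le_one hrev hΛl hl hb n)

end FeynmanKac

section CenteredTest

variable {G : Type*} [MeasurableSpace G] {K : Kernel G G} [IsMarkovKernel K] {π : Measure G}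
  [IsProbabilityMeasure π] {l m : ℝ} {f : G → ℝ}

theorem one_sub_sq_le_one_add_sq_sub {p t : ℝ} (hm : 0 ≤ m) (hp : 0 ≤ p) (ht : t ≤ 1) :
    (1 - m) ^ 2 ≤ 1 + m ^ 2 - 2 * m * (t - p) := by
  nlinarith [mul_le_mul_of_nonneg_left (show t - p ≤ 1 by linarith) hm]

theorem div_add_div_le_one {p : ℝ} (h_one : 0 < 1 + m ^ 2 - 2 * m * (1 - p))
    (h_zero : 0 < 1 + m ^ 2 - 2 * m * (0 - p)) :
    p / (1 + m ^ 2 - 2 * m * (1 - p)) + (1 - p) / (1 + m ^ 2 - 2 * m * (0 - p)) ≤ 1 := by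
  -- The product of the denominators exceeds the numerator by `(m * (m + 2 * p - 1)) ^ 2`.
  rw [div_add_div _ _ h_one.ne' h_zero.ne', div_le_one (mul_pos h_one h_zero)]
  linarith [sq_nonneg (m * (m + 2 * p - 1))]

theorem integral_inv_one_add_sq_sub_le_one (hm : 0 ≤ m) (hm_one : m < 1) (hf : Measurable f)
    (hf_mem : ∀ x, f x ∈ Set.Icc 0 1) :
    ∫ x, (1 + m ^ 2 - 2 * m * (f x - ∫ y, f y ∂π))⁻¹ ∂π ≤ 1 := by
  have hf_bdd : IsBddMeas f := .of_mem_Icc hf hf_mem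
  set p := ∫ y, f y ∂π
  have hp : 0 ≤ p := integral_nonneg fun x => (hf_mem x).1
  set D : ℝ → ℝ := fun t => 1 + m ^ 2 - 2 * m * (t - p)
  have h_pos : 0 < (1 - m) ^ 2 := by nlinarith
  have h_le (t : ℝ) (ht : t ≤ 1) : (1 - m) ^ 2 ≤ D t := one_sub_sq_le_one_add_sq_sub hm hp ht
  have h_one : 0 < D 1 := h_pos.trans_le (h_le 1 le_rfl)
  have h_zero : 0 < D 0 := h_pos.trans_le (h_le 0 zero_le_one)
  -- Convexity of the inverse reduces everything to a `{0, 1}`-valued `f`.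
  have h_convex (x) : (D (f x))⁻¹ ≤ f x * (D 1)⁻¹ + (1 - f x) * (D 0)⁻¹ := by
    have h_affine : f x * D 1 + (1 - f x) * D 0 = D (f x) := by simp only [D]; ring
    simpa only [zpow_neg_one, smul_eq_mul, h_affine] using (convexOn_zpow (-1)).2 h_one h_zero
      (hf_mem x).1 (sub_nonneg.mpr (hf_mem x).2) (add_sub_cancel _ _)
  calc ∫ x, (D (f x))⁻¹ ∂π ≤ ∫ x, (f x * (D 1)⁻¹ + (1 - f x) * (D 0)⁻¹) ∂π :=
        integral_mono ((IsBddMeas.inv_of_le (by fun_prop) h_pos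
          fun x => h_le _ (hf_mem x).2).integrable π)
          (IsBddMeas.integrable (by fun_prop) _) h_convex
    _ = p / D 1 + (1 - p) / D 0 := by
        rw [integral_add (IsBddMeas.integrable (by fun_prop) _)
          (IsBddMeas.integrable (by fun_prop) _), integral_mul_const, integral_mul_const,
          integral_sub (integrable_const _) (hf_bdd.integrable π), integral_const, probReal_univ,
          one_smul, div_eq_mul_inv, div_eq_mul_inv]
    _ ≤ 1 := div_add_div_le_one h_one h_zero

theorem integral_feynmanKac_centered_le_one (hrev : K.IsReversible π)
    (hΛl : spectralSup K hrev ≤ l) (hl : 0 ≤ l) (hl_one : l ≤ 1) (hm : 0 ≤ m) (hm_one : m < 1)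
    (hf : Measurable f) (hf_mem : ∀ x, f x ∈ Set.Icc 0 1) (n : ℕ) :
    ∫ x, feynmanKac K (fun y => (1 - l) * (2 * m * (f y - ∫ z, f z ∂π) - m ^ 2)) n x ∂π ≤ 1 := by
  have hf_bdd : IsBddMeas f := .of_mem_Icc hf hf_mem
  have h_pos : 0 < (1 - m) ^ 2 := by nlinarith
  have h_le (x) : (1 - m) ^ 2 ≤ 1 + m ^ 2 - 2 * m * (f x - ∫ z, f z ∂π) :=
    one_sub_sq_le_one_add_sq_sub hm (integral_nonneg fun x => (hf_mem x).1) (hf_mem x).2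
  refine IsSubcritical.integral_feynmanKac_le_one ?_ hrev hΛl hl (by fun_prop) n
  refine .of_integral_inv_le_one hl_one (by fun_prop) (by fun_prop)
    (.inv_of_le (by fun_prop) h_pos h_le) (fun x => h_pos.trans_le (h_le x))
    (integral_inv_one_add_sq_sub_le_one hm hm_one hf hf_mem) fun x => ?_
  linarith [Real.add_one_le_exp (-((1 - l) * (2 * m * (f x - ∫ z, f z ∂π) - m ^ 2)))]

end CenteredTest

section DrivenChain

variable {G : Type*} {s n : ℕ}

theorem drivenPoint_succ (φ : G → Cube s → G) (ψ : Cube s → G) (u : Fin (n + 1) → Cube s) (i : ℕ)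
    (hi : i + 1 < n + 1) :
    drivenPoint φ ψ u (i + 1) hi =
      drivenPoint φ (φ (ψ (u 0))) (fun j => u j.succ) i (Nat.lt_of_succ_lt_succ hi) := by
  induction i with
  | zero => rfl
  | succ i ih =>
    rw [drivenPoint, ih (Nat.lt_of_succ_lt hi)]
    rfl

theorem sum_drivenPoints_succ (φ : G → Cube s → G) (ψ : Cube s → G) (u : Fin (n + 1) → Cube s)
    (b : G → ℝ) :
    ∑ i, b (drivenPoints φ ψ u i) =
      b (ψ (u 0)) + ∑ i, b (drivenPoints φ (φ (ψ (u 0))) (fun j => u j.succ) i) := by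
  rw [Fin.sum_univ_succ]
  refine congrArg₂ _ rfl (Finset.sum_congr rfl fun i _ => congrArg b ?_)
  exact drivenPoint_succ φ ψ u i _

variable [MeasurableSpace G] {φ : G → Cube s → G} {ψ : Cube s → G}

theorem measurable_drivenPoint (hφ : Measurable (Function.uncurry φ)) (hψ : Measurable ψ) (i : ℕ)
    (hi : i < n) : Measurable fun u : Fin n → Cube s => drivenPoint φ ψ u i hi := by
  induction i with
  | zero => exact hψ.comp (measurable_pi_apply _)
  | succ i ih => exact hφ.comp ((ih (Nat.lt_of_succ_lt hi)).prodMk (measurable_pi_apply _))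

theorem isBddMeas_sum_drivenPoints (hφ : Measurable (Function.uncurry φ)) (hψ : Measurable ψ)
    {b : G → ℝ} (hb : IsBddMeas b) :
    IsBddMeas fun u : Fin n → Cube s => ∑ i, b (drivenPoints φ ψ u i) :=
  .sum _ fun i _ => hb.comp (measurable_drivenPoint hφ hψ i i.isLt)

theorem IsGeneratorFunction.map_eq {ν : Measure G} (hψ : IsGeneratorFunction ν ψ) :
    (volume : Measure (Cube s)).map ψ = ν := by
  ext A hA
  rw [Measure.map_apply hψ.1 hA, hψ.2 A hA]
  rfl

theorem IsUpdateFunction.isGeneratorFunction {K : Kernel G G} (hφ : IsUpdateFunction K φ) (x : G) :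
    IsGeneratorFunction (K x) (φ x) :=
  ⟨hφ.1.comp measurable_prodMk_left, hφ.2 x⟩

theorem integral_exp_sum_drivenPoints {K : Kernel G G} [IsMarkovKernel K]
    (hφ : IsUpdateFunction K φ) {b : G → ℝ} (hb : IsBddMeas b) {ν : Measure G}
    [IsProbabilityMeasure ν] (hψ : IsGeneratorFunction ν ψ) :
    ∫ u : Fin n → Cube s, Real.exp (∑ i, b (drivenPoints φ ψ u i)) =
      ∫ x, feynmanKac K b n x ∂ν := by
  induction n generalizing ν ψ with
  | zero => simp [feynmanKac]
  | succ n ih =>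
    have h_split := (volume_preserving_piFinSuccAbove (fun _ : Fin (n + 1) => Cube s) 0).symm
    have h_bdd := (isBddMeas_sum_drivenPoints (n := n + 1) hφ.1 hψ.1 hb).exp
    rw [← h_split.integral_comp (MeasurableEquiv.measurableEmbedding _), Measure.volume_eq_prod,
      integral_prod _ ((h_bdd.comp (MeasurableEquiv.measurable _)).integrable _), ← hψ.map_eq,
      integral_map hψ.1.aemeasurable (hb.feynmanKac (n + 1)).1.aestronglyMeasurable]
    congr with u₀
    calc _ = ∫ u : Fin n → Cube s,
          Real.exp (b (ψ u₀)) * Real.exp (∑ i, b (drivenPoints φ (φ (ψ u₀)) u i)) := by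
          congr with u
          rw [sum_drivenPoints_succ, Real.exp_add]
          rfl
      _ = _ := by
          rw [integral_const_mul, ih (hφ.isGeneratorFunction (ψ u₀))]
          rfl

end DrivenChain

section ChangeOfMeasure

variable {G : Type*} [MeasurableSpace G] {π ν : Measure G}

theorem integral_le_lpNorm_density_mul [IsFiniteMeasure π] [SigmaFinite ν] (hac : ν ≪ π)
    (hdens : MemLp (density ν π) 2 π) {F : G → ℝ} (hF : IsBddMeas F) (hF_nonneg : ∀ x, 0 ≤ F x) :
    ∫ x, F x ∂ν ≤ lpNorm (density ν π) 2 π * √(∫ x, F x ^ 2 ∂π) := by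
  have h_density (x) : 0 ≤ density ν π x := ENNReal.toReal_nonneg
  have h_change : ∫ x, F x ∂ν = ∫ x, density ν π x * F x ∂π :=
    (integral_toReal_rnDeriv_mul hac).symm
  have h_cauchySchwarz := integral_mul_le_Lp_mul_Lq_of_nonneg Real.HolderConjugate.two_two
    (Filter.Eventually.of_forall h_density) (Filter.Eventually.of_forall hF_nonneg)
    (by simpa using hdens) (hF.memLp π _)
  rw [h_change]
  refine h_cauchySchwarz.trans_eq ?_
  rw [lpNorm_eq_integral_norm_rpow_toReal (by norm_num) (by norm_num) hdens.1, Real.sqrt_eq_rpow]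
  simp only [ENNReal.toReal_ofNat, Real.norm_eq_abs, abs_of_nonneg (h_density _), Real.rpow_ofNat,
    one_div]

theorem one_le_lpNorm_density [IsProbabilityMeasure π] [IsProbabilityMeasure ν] (hac : ν ≪ π)
    (hdens : MemLp (density ν π) 2 π) :
    1 ≤ lpNorm (density ν π) 2 π := by
  simpa using integral_le_lpNorm_density_mul hac hdens (.const 1) fun _ => zero_le_one

end ChangeOfMeasure

section Deviation

variable {G : Type*} [MeasurableSpace G] {K : Kernel G G} [IsMarkovKernel K] {π ν : Measure G}
  [IsProbabilityMeasure π] [IsProbabilityMeasure ν] {s n : ℕ} {φ : G → Cube s → G}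
  {ψ : Cube s → G} {l c : ℝ} {f : G → ℝ}

theorem integral_exp_sum_centered_le (hrev : K.IsReversible π) (hac : ν ≪ π)
    (hdens : MemLp (density ν π) 2 π) (hφ : IsUpdateFunction K φ) (hψ : IsGeneratorFunction ν ψ)
    (hΛl : spectralSup K hrev ≤ l) (hl : 0 ≤ l) (hl_one : l ≤ 1) (hc : 0 ≤ c) (hc_one : c < 1)
    (hf : Measurable f) (hf_mem : ∀ x, f x ∈ Set.Icc 0 1) :
    ∫ u : Fin n → Cube s, Real.exp (∑ i, (1 - l) *
        (c * (f (drivenPoints φ ψ u i) - ∫ x, f x ∂π) - c ^ 2 / 2)) ≤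
      lpNorm (density ν π) 2 π := by
  have hf_bdd : IsBddMeas f := .of_mem_Icc hf hf_mem
  set b : G → ℝ := fun y => (1 - l) * (c * (f y - ∫ x, f x ∂π) - c ^ 2 / 2)
  have hb : IsBddMeas b := by fun_prop
  have h_double : (fun y => 2 * b y) =
      fun y => (1 - l) * (2 * c * (f y - ∫ x, f x ∂π) - c ^ 2) := by
    ext y
    ring
  have h_sq : ∫ x, feynmanKac K b n x ^ 2 ∂π ≤ 1 := calc
    ∫ x, feynmanKac K b n x ^ 2 ∂π ≤ ∫ x, feynmanKac K (fun y => 2 * b y) n x ∂π :=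
      integral_mono (IsBddMeas.integrable (by fun_prop) _) (IsBddMeas.integrable (by fun_prop) _)
        (sq_feynmanKac_le hb n)
    _ ≤ 1 := by
      rw [h_double]
      exact integral_feynmanKac_centered_le_one hrev hΛl hl hl_one hc hc_one hf hf_mem n
  calc ∫ u : Fin n → Cube s, Real.exp (∑ i, b (drivenPoints φ ψ u i))
      = ∫ x, feynmanKac K b n x ∂ν := integral_exp_sum_drivenPoints hφ hb hψ
    _ ≤ lpNorm (density ν π) 2 π * √(∫ x, feynmanKac K b n x ^ 2 ∂π) :=
        integral_le_lpNorm_density_mul hac hdens (hb.feynmanKac n) (feynmanKac_nonneg K b n)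
    _ ≤ lpNorm (density ν π) 2 π :=
        mul_le_of_le_one_right lpNorm_nonneg (Real.sqrt_le_one.mpr h_sq)

theorem measureReal_le_sum_sub_le (hrev : K.IsReversible π) (hac : ν ≪ π)
    (hdens : MemLp (density ν π) 2 π) (hφ : IsUpdateFunction K φ) (hψ : IsGeneratorFunction ν ψ)
    (hΛl : spectralSup K hrev ≤ l) (hl : 0 ≤ l) (hl_one : l ≤ 1) (hc : 0 ≤ c) (hc_one : c < 1)
    (hf : Measurable f) (hf_mem : ∀ x, f x ∈ Set.Icc 0 1) :
    volume.real {u : Fin n → Cube s |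
        n * c ≤ ∑ i, (f (drivenPoints φ ψ u i) - ∫ x, f x ∂π)} ≤
      lpNorm (density ν π) 2 π * Real.exp (-(n * (1 - l) * c ^ 2 / 2)) := by
  have hf_bdd : IsBddMeas f := .of_mem_Icc hf hf_mem
  set b : G → ℝ := fun y => (1 - l) * (c * (f y - ∫ x, f x ∂π) - c ^ 2 / 2)
  have hb : IsBddMeas b := by fun_prop
  have h_sum (u : Fin n → Cube s) : ∑ i, b (drivenPoints φ ψ u i)
      = (1 - l) * (c * ∑ i, (f (drivenPoints φ ψ u i) - ∫ x, f x ∂π) - n * (c ^ 2 / 2)) := by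
    simp only [b, ← Finset.mul_sum, Finset.sum_sub_distrib, Finset.sum_const, Finset.card_univ,
      Fintype.card_fin, nsmul_eq_mul]
  have h_subset : {u : Fin n → Cube s |
        n * c ≤ ∑ i, (f (drivenPoints φ ψ u i) - ∫ x, f x ∂π)} ⊆
      {u | Real.exp (n * (1 - l) * c ^ 2 / 2) ≤ Real.exp (∑ i, b (drivenPoints φ ψ u i))} := by
    intro u hu
    refine Real.exp_le_exp.mpr ?_
    rw [h_sum]
    nlinarith [mul_le_mul_of_nonneg_left (mul_le_mul_of_nonneg_left hu.out hc)
      (sub_nonneg.mpr hl_one)]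
  have h_markov := mul_meas_ge_le_integral_of_nonneg (μ := volume)
    (Filter.Eventually.of_forall fun u : Fin n → Cube s => (Real.exp_pos _).le)
    ((isBddMeas_sum_drivenPoints hφ.1 hψ.1 hb).exp.integrable _)
    (Real.exp (n * (1 - l) * c ^ 2 / 2))
  rw [Real.exp_neg, ← div_eq_mul_inv, le_div_iff₀' (Real.exp_pos _)]
  calc _ ≤ _ := mul_le_mul_of_nonneg_left (measureReal_mono h_subset) (Real.exp_pos _).le
    _ ≤ _ := h_markov
    _ ≤ _ := integral_exp_sum_centered_le hrev hac hdens hφ hψ hΛl hl hl_one hc hc_one hf hf_mem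

theorem measureReal_lt_abs_average_sub_integral_le (hrev : K.IsReversible π) (hac : ν ≪ π)
    (hdens : MemLp (density ν π) 2 π) (hφ : IsUpdateFunction K φ) (hψ : IsGeneratorFunction ν ψ)
    (hΛl : spectralSup K hrev ≤ l) (hl : 0 ≤ l) (hl_one : l ≤ 1) (hc : 0 ≤ c) (hc_one : c < 1)
    (hn : 1 ≤ n) (hf : Measurable f) (hf_mem : ∀ x, f x ∈ Set.Icc 0 1) :
    volume.real {u : Fin n → Cube s |
        c < |(1 / (n : ℝ)) * ∑ i, f (drivenPoints φ ψ u i) - ∫ x, f x ∂π|} ≤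
      2 * (lpNorm (density ν π) 2 π * Real.exp (-(n * (1 - l) * c ^ 2 / 2))) := by
  have hn_pos : (0 : ℝ) < n := by exact_mod_cast hn
  have h_compl : ∫ x, (1 - f x) ∂π = 1 - ∫ x, f x ∂π := by
    rw [integral_sub (integrable_const _) ((IsBddMeas.of_mem_Icc hf hf_mem).integrable π)]
    simp
  have h_upper := measureReal_le_sum_sub_le (n := n) hrev hac hdens hφ hψ hΛl hl hl_one hc hc_one
    hf hf_mem
  have h_lower := measureReal_le_sum_sub_le (n := n) (f := fun x => 1 - f x) hrev hac hdens hφ hψ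
    hΛl hl hl_one hc hc_one (measurable_const.sub hf) fun x =>
      ⟨by linarith [(hf_mem x).2], by linarith [(hf_mem x).1]⟩
  refine (measureReal_mono (fun u hu => ?_)).trans ((measureReal_union_le _ _).trans
    ((add_le_add h_upper h_lower).trans_eq (two_mul _).symm))
  have h_average : (1 / (n : ℝ)) * ∑ i, f (drivenPoints φ ψ u i) - ∫ x, f x ∂π
      = (∑ i, (f (drivenPoints φ ψ u i) - ∫ x, f x ∂π)) / n := by
    simp only [Finset.sum_sub_distrib, Finset.sum_const, Finset.card_univ, Fintype.card_fin,
      nsmul_eq_mul]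
    field_simp
  rw [Set.mem_ofPred_eq, h_average, lt_abs, ← neg_div, lt_div_iff₀' hn_pos, lt_div_iff₀' hn_pos]
    at hu
  refine hu.imp le_of_lt fun h => ?_
  rw [Set.mem_ofPred_eq, h_compl]
  simpa only [sub_sub_sub_cancel_left, neg_sub, ← Finset.sum_neg_distrib] using h.le

theorem exists_forall_abs_average_sub_integral_le (hrev : K.IsReversible π) (hac : ν ≪ π)
    (hdens : MemLp (density ν π) 2 π) (hφ : IsUpdateFunction K φ) (hψ : IsGeneratorFunction ν ψ)
    (hΛl : spectralSup K hrev ≤ l) (hl : 0 ≤ l) (hl_one : l ≤ 1) (hc : 0 ≤ c) (hc_one : c < 1)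
    (hn : 1 ≤ n) {ι : Type*} (t : Finset ι) {f : ι → G → ℝ} (hf : ∀ j ∈ t, Measurable (f j))
    (hf_mem : ∀ j ∈ t, ∀ x, f j x ∈ Set.Icc 0 1)
    (h_small : t.card *
      (2 * (lpNorm (density ν π) 2 π * Real.exp (-(n * (1 - l) * c ^ 2 / 2)))) < 1) :
    ∃ u : Fin n → Cube s, ∀ j ∈ t,
      |(1 / (n : ℝ)) * ∑ i, f j (drivenPoints φ ψ u i) - ∫ x, f j x ∂π| ≤ c := by
  set bad : ι → Set (Fin n → Cube s) := fun j =>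
    {u | c < |(1 / (n : ℝ)) * ∑ i, f j (drivenPoints φ ψ u i) - ∫ x, f j x ∂π|}
  have h_bad : volume.real (⋃ j ∈ t, bad j) < 1 := by
    refine ((measureReal_biUnion_finset_le _ _).trans ?_).trans_lt h_small
    rw [← nsmul_eq_mul]
    exact Finset.sum_le_card_nsmul _ _ _ fun j hj =>
      measureReal_lt_abs_average_sub_integral_le hrev hac hdens hφ hψ hΛl hl hl_one hc hc_one hn
        (hf j hj) (hf_mem j hj)
  obtain ⟨u, hu⟩ : ∃ u, u ∉ ⋃ j ∈ t, bad j := by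
    by_contra! h_all
    simp [Set.eq_univ_of_forall h_all] at h_bad
  refine ⟨u, fun j hj => not_lt.mp fun h => hu ?_⟩
  exact Set.mem_biUnion hj h

end Deviation

section Discrepancy

variable {G : Type*} {n : ℕ}

theorem average_indicator_mono {A B : Set G} (h : A ⊆ B) (x : Fin n → G) :
    (1 / (n : ℝ)) * ∑ i, A.indicator (fun _ => (1 : ℝ)) (x i) ≤
      (1 / (n : ℝ)) * ∑ i, B.indicator (fun _ => (1 : ℝ)) (x i) := by
  gcongr

variable [MeasurableSpace G] {π ν : Measure G}

theorem starDiscrepancy_le_of_isDeltaCover [IsFiniteMeasure π] {𝒜 : Set (Set G)}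
    {Γ : Finset (Set G)} {δ c : ℝ} (hδ : 0 ≤ δ) (hc : 0 ≤ c) (hΓ : IsDeltaCover 𝒜 π δ Γ)
    (x : Fin n → G)
    (hx : ∀ C ∈ Γ,
      |(1 / (n : ℝ)) * ∑ i, C.indicator (fun _ => (1 : ℝ)) (x i) - π.real C| ≤ c) :
    starDiscrepancy 𝒜 π x ≤ c + δ := by
  refine Real.iSup_le (fun ⟨A, hA⟩ => ?_) (by positivity)
  obtain ⟨C, hC, D, hD, hCA, hAD, hCD⟩ := hΓ.2.2 A hA
  have h_lower := (abs_le.mp (hx C hC)).1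
  have h_upper := (abs_le.mp (hx D hD)).2
  have h_averageC := average_indicator_mono hCA x
  have h_averageD := average_indicator_mono hAD x
  have h_measureC : π.real C ≤ π.real A := measureReal_mono hCA
  have h_measureD : π.real A ≤ π.real D := measureReal_mono hAD
  have h_gap : π.real D - π.real C ≤ π.real (D \ C) := le_measureReal_sdiff
  rw [abs_le]
  constructor <;> linarith

theorem sub_one_mul_lt_one {k a e : ℝ} (hk : 1 ≤ k) (ha : 0 < a) (he : e ≤ (k ^ 2 * a)⁻¹) :
    (k - 1) * (2 * (a * e)) < 1 := by
  have h_le : a * e ≤ 1 / k ^ 2 := calc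
    a * e ≤ a * (k ^ 2 * a)⁻¹ := by gcongr
    _ = 1 / k ^ 2 := by field_simp
  calc (k - 1) * (2 * (a * e)) ≤ (k - 1) * (2 * (1 / k ^ 2)) := by
        have := sub_nonneg.mpr hk
        gcongr
    _ = 2 * (k - 1) / k ^ 2 := by ring
    _ < 1 := by
        rw [div_lt_one (by positivity)]
        nlinarith [sq_nonneg (k - 1)]

variable [IsProbabilityMeasure π] [IsProbabilityMeasure ν]

theorem starDiscrepancy_le_one (hn : 1 ≤ n) (𝒜 : Set (Set G)) (x : Fin n → G) :
    starDiscrepancy 𝒜 π x ≤ 1 := by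
  refine Real.iSup_le (fun ⟨A, _⟩ => ?_) zero_le_one
  have h_nonneg := average_indicator_mono (Set.empty_subset A) x
  have h_le_one := average_indicator_mono (Set.subset_univ A) x
  have hn_ne : (n : ℝ) ≠ 0 := by positivity
  simp only [Set.indicator_empty, Set.indicator_univ, Finset.sum_const, Finset.card_univ,
    Fintype.card_fin, nsmul_eq_mul, mul_zero, mul_one, one_div_mul_cancel hn_ne]
    at h_nonneg h_le_one
  exact abs_sub_le_of_nonneg_of_le h_nonneg h_le_one measureReal_nonneg measureReal_le_one

theorem exists_starDiscrepancy_le {K : Kernel G G} [IsMarkovKernel K] {s : ℕ}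
    {φ : G → Cube s → G} {ψ : Cube s → G} {l c δ : ℝ} {𝒜 : Set (Set G)} {Γ : Finset (Set G)}
    (hrev : K.IsReversible π) (hac : ν ≪ π)
    (hdens : MemLp (density ν π) 2 π) (hφ : IsUpdateFunction K φ) (hψ : IsGeneratorFunction ν ψ)
    (hΛl : spectralSup K hrev ≤ l) (hl : 0 ≤ l) (hl_one : l ≤ 1) (hc : 0 ≤ c) (hn : 1 ≤ n)
    (hδ : 0 ≤ δ) (hΓ : IsDeltaCover 𝒜 π δ Γ)
    (h_small : Real.exp (-(n * (1 - l) * c ^ 2 / 2)) ≤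
      (Γ.card ^ 2 * lpNorm (density ν π) 2 π)⁻¹) :
    ∃ u : Fin n → Cube s, starDiscrepancy 𝒜 π (drivenPoints φ ψ u) ≤ c + δ := by
  classical
  rcases le_or_gt 1 c with hc_one | hc_one
  · exact ⟨fun _ _ => 0, (starDiscrepancy_le_one hn 𝒜 _).trans (by linarith)⟩
  have h_card : (1 : ℝ) ≤ Γ.card := by exact_mod_cast Finset.card_pos.mpr ⟨∅, hΓ.2.1⟩
  have h_norm : 1 ≤ lpNorm (density ν π) 2 π := one_le_lpNorm_density hac hdens
  -- `∅` has no deviation, and sparing it makes the union bound strict.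
  have h_union : (Γ.erase ∅).card *
      (2 * (lpNorm (density ν π) 2 π * Real.exp (-(n * (1 - l) * c ^ 2 / 2)))) < 1 := by
    rw [Finset.cast_card_erase_of_mem hΓ.2.1]
    exact sub_one_mul_lt_one h_card (by linarith) h_small
  obtain ⟨u, hu⟩ := exists_forall_abs_average_sub_integral_le hrev hac hdens hφ hψ hΛl hl hl_one
    hc hc_one hn (Γ.erase ∅) (f := fun C => C.indicator fun _ => 1)
    (fun C hC => measurable_const.indicator (hΓ.1 C (Finset.mem_of_mem_erase hC)))
    (fun C _ x => ⟨Set.indicator_nonneg (fun _ _ => zero_le_one) x,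
      Set.indicator_le_self' (fun _ _ => zero_le_one) x⟩)
    h_union
  refine ⟨u, starDiscrepancy_le_of_isDeltaCover hδ hc hΓ _ fun C hC => ?_⟩
  obtain rfl | hC_ne := eq_or_ne C ∅
  · simpa using hc
  · simpa [integral_indicator_const _ (hΓ.1 C hC)] using hu C (Finset.mem_erase.mpr ⟨hC_ne, hC⟩)

theorem exp_neg_mul_sq_eq_inv {l a : ℝ} (hl : l < 1) (ha : 1 ≤ a) (hn : 1 ≤ n) :
    Real.exp (-(n * (1 - l) * (√(1 / (1 - l)) * (√(2 * Real.log a) / √(n : ℝ))) ^ 2 / 2)) =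
      a⁻¹ := by
  have hl_pos : 0 < 1 - l := sub_pos.mpr hl
  have h_log : 0 ≤ 2 * Real.log a := mul_nonneg zero_le_two (Real.log_nonneg ha)
  rw [mul_pow, div_pow, Real.sq_sqrt (one_div_nonneg.mpr hl_pos.le), Real.sq_sqrt h_log,
    Real.sq_sqrt n.cast_nonneg]
  have h_eq : n * (1 - l) * (1 / (1 - l) * (2 * Real.log a / n)) / 2 = Real.log a := by
    have : (n : ℝ) ≠ 0 := by positivity
    field_simp
  rw [h_eq, Real.exp_neg, Real.exp_log (by linarith)]

end Discrepancy

end MCQMC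

theorem mainTheorem1_general {G : Type*} [MeasurableSpace G] {π ν : Measure G}
    [IsProbabilityMeasure π] [IsProbabilityMeasure ν] {K : Kernel G G} [IsMarkovKernel K]
    (hrev : K.IsReversible π) (hvb : MCQMC.IsVarianceBounding K hrev)
    (hac : ν ≪ π) (hdens : MemLp (MCQMC.density ν π) 2 π) {𝒜 : Set (Set G)} {δ : ℝ} (hδ : 0 ≤ δ)
    {Γ : Finset (Set G)} (hΓ : MCQMC.IsDeltaCover 𝒜 π δ Γ) {s : ℕ}
    {φ : G → MCQMC.Cube s → G} (hφ : MCQMC.IsUpdateFunction K φ)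
    {ψ : MCQMC.Cube s → G} (hψ : MCQMC.IsGeneratorFunction ν ψ) {n : ℕ} (hn : 1 ≤ n) :
    ∃ u : Fin n → MCQMC.Cube s,
      MCQMC.starDiscrepancy 𝒜 π (MCQMC.drivenPoints φ ψ u) ≤
        √(1 / (1 - max 0 (MCQMC.spectralSup K hrev))) *
          (√(2 * Real.log ((Γ.card : ℝ) ^ 2 * lpNorm (MCQMC.density ν π) 2 π)) / √(n : ℝ)) +
        δ := by
  have hl : max 0 (MCQMC.spectralSup K hrev) < 1 := max_lt one_pos hvb
  have h_card : (1 : ℝ) ≤ Γ.card := by exact_mod_cast Finset.card_pos.mpr ⟨∅, hΓ.2.1⟩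
  have h_prod : 1 ≤ (Γ.card : ℝ) ^ 2 * lpNorm (MCQMC.density ν π) 2 π :=
    one_le_mul_of_one_le_of_one_le (one_le_pow₀ h_card) (MCQMC.one_le_lpNorm_density hac hdens)
  exact MCQMC.exists_starDiscrepancy_le hrev hac hdens hφ hψ (le_max_right _ _) (le_max_left _ _)
    hl.le (by positivity) hn hδ hΓ (MCQMC.exp_neg_mul_sq_eq_inv hl h_prod hn).le

theorem mainTheorem1 {d : ℕ} (G : Set (EuclideanSpace ℝ (Fin d)))
    (π ν : Measure G) [IsProbabilityMeasure π] [IsProbabilityMeasure ν]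
    (K : Kernel G G) [IsMarkovKernel K]
    (hrev : K.IsReversible π) (hvb : MCQMC.IsVarianceBounding K hrev)
    (hac : ν ≪ π) (hdens : MemLp (MCQMC.density ν π) 2 π)
    (𝒜 : Set (Set G)) (h𝒜 : ∀ A ∈ 𝒜, MeasurableSet A)
    (Γ : ℝ → Finset (Set G)) (hΓ : ∀ δ : ℝ, 0 < δ → MCQMC.IsDeltaCover 𝒜 π δ (Γ δ))
    {s : ℕ} (φ : G → MCQMC.Cube s → G) (hφ : MCQMC.IsUpdateFunction K φ)
    (ψ : MCQMC.Cube s → G) (hψ : MCQMC.IsGeneratorFunction ν ψ)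
    (n : ℕ) (hn : 1 ≤ n) (δ : ℝ) (hδ : 0 < δ) :
    ∃ u : Fin n → MCQMC.Cube s,
      MCQMC.starDiscrepancy 𝒜 π (MCQMC.drivenPoints φ ψ u) ≤
        √((1 + max 0 (MCQMC.spectralSup K hrev)) / (1 - max 0 (MCQMC.spectralSup K hrev))) *
          (√(2 * Real.log (((Γ δ).card : ℝ) ^ 2 * lpNorm (MCQMC.density ν π) 2 π)) / √(n : ℝ)) +
        δ := by
  obtain ⟨u, hu⟩ := mainTheorem1_general hrev hvb hac hdens hδ.le (hΓ δ hδ) hφ hψ hn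
  have hl : max 0 (MCQMC.spectralSup K hrev) < 1 := max_lt one_pos hvb
  refine ⟨u, hu.trans ?_⟩
  gcongr
  exact le_add_of_nonneg_right (le_max_left _ _)
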